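/- All vector spaces are finite-dimensional over $\mathbb C$. A bialgebra is an associative unital algebra which is also a coassociative counital coalgebra, such that the comultiplication $\Delta$ and the counit $\varepsilon$ are unital algebra homomorphisms. An *involutive bialgebra* is a bialgebra $A$ with two antilinear maps $\sharp,\flat:A\to A$ of order two, the involution and the coinvolution, such that for all $x,y\in A$ $$(xy)^\sharp=y^\sharp x^\sharp,\qquad \Delta(x^\flat)=J(\flat\otimes\flat)\Delta(x),\qquad \Delta(x^\sharp)=(\sharp\otimes\sharp)\Delta(x),\qquad (xy)^\flat=x^\flat y^\flat,$$ where $J(x\otimes y)=y\otimes x$. The dual space $A'$ is a bialgebra with the multiplication, unit, comultiplication and counit adjoint to the comultiplication, counit, multiplication and unit of $A$; its involution is $f\mapsto\big(x\mapsto\overline{f(x^\flat)}\big)$ and its coinvolution is $f\mapsto\big(x\mapsto\overline{f(x^\sharp)}\big)$. The involutive bialgebra $A$ is called *semisimple* if both $A$ and $A'$ are semisimple as algebras with involution, that is, the algebra is semisimple and $x^\sharp x=0$ implies $x=0$ (equivalently, it is isomorphic, as an algebra with involution, to a direct sum of full matrix algebras over $\mathbb C$ with the conjugate transpose). An isomorphism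 of involutive bialgebras is a bialgebra isomorphism that commutes with the involutions and with the coinvolutions. An inverse semigroup is a semigroup $S$ in which every element $a$ has a unique inverse $a^*$, i.e. a unique element with $aa^*a=a$ and $a^*aa^*=a^*$. The semigroup algebra $\mathbb C(S)$ of a finite inverse semigroup $S$ with identity element carries the multiplication of $S$ extended linearly, $\Delta(s)=s\otimes s$, $\varepsilon(s)=1$, the involution $\sum_s c_s s\mapsto\sum_s\overline{c_s}\,s^*$ and the coinvolution $\sum_s c_s s\mapsto\sum_s\overline{c_s}\,s$. **Theorem 2.** The semigroup algebra $\mathbb C(S)$ of every finite inverse unital semigroup $S$ is a semisimple cocommutative involutive bialgebra, and its dual $\mathbb C(S)'$ is a semisimple commutative involutive bialgebra. Conversely, every finite-dimensional semisimple cocommutative (respectively, commutative) involutive bialgebra is isomorphic, as an involutive bialgebra, to the semigroup algebra $\mathbb C(S)$ (respectively, to its dual $\mathbb C(S)'$) of some finite inverse unital semigroup $S$. -/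

import Mathlib

open scoped TensorProduct ComplexConjugate

universe u v

noncomputable section

namespace InvBialg

open Coalgebra

/-! ### The dual bialgebra of a finite-dimensional complex bialgebra -/

/-- The dual algebra `A'` of `A`: the space of linear functionals on `A` with Mathlib's convolution
product `(f * g)(x) = ∑ f(x₁) g(x₂)`, whose unit is the counit of `A`. -/
def DualSpace (A : Type*) [Ring A] [Bialgebra ℂ A] : Type _ :=
  WithConv (A →ₗ[ℂ] ℂ)

section Dual

section Algebra

variable {A : Type*} [Ring A] [Bialgebra ℂ A]

instance : Ring (DualSpace A) := inferInstanceAs (Ring (WithConv (A →ₗ[ℂ] ℂ)))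

instance : Algebra ℂ (DualSpace A) := inferInstanceAs (Algebra ℂ (WithConv (A →ₗ[ℂ] ℂ)))

variable (A) in
/-- Elements of `A'` as linear functionals. -/
def functional : DualSpace A ≃ₗ[ℂ] Module.Dual ℂ A where
  toFun f := WithConv.ofConv f
  invFun f := WithConv.toConv f
  map_add' _ _ := rfl
  map_smul' _ _ := rfl
  left_inv _ := rfl
  right_inv _ := rfl

instance : FunLike (DualSpace A) A ℂ where
  coe f := functional A f
  coe_injective _ _ h := (functional A).injective (DFunLike.coe_injective h)

lemma coe_functional (f : DualSpace A) (x : A) : functional A f x = f x := rfl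

@[ext] lemma dual_ext {f g : DualSpace A} (h : ∀ x, f x = g x) : f = g := DFunLike.ext _ _ h

instance : LinearMapClass (DualSpace A) ℂ A ℂ where
  map_add f := (functional A f).map_add
  map_smulₛₗ f := (functional A f).map_smul

@[simp] lemma functional_symm_apply (φ : Module.Dual ℂ A) (x : A) :
    (functional A).symm φ x = φ x := rfl

@[simp] lemma dual_zero_apply (x : A) : (0 : DualSpace A) x = 0 := rfl

@[simp] lemma dual_add_apply (f g : DualSpace A) (x : A) : (f + g) x = f x + g x := rfl

@[simp] lemma dual_smul_apply (c : ℂ) (f : DualSpace A) (x : A) : (c • f) x = c * f x := rfl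

@[simp] lemma dual_one_apply (x : A) : (1 : DualSpace A) x = counit (R := ℂ) x := rfl

lemma dual_mul_apply (f g : DualSpace A) (x : A) :
    (f * g) x = LinearMap.mul' ℂ ℂ
      (TensorProduct.map (functional A f) (functional A g) (comul (R := ℂ) x)) := rfl

end Algebra

variable (A : Type*) [Ring A] [Bialgebra ℂ A] [Module.Finite ℂ A]

instance : Module.Finite ℂ (DualSpace A) := Module.Finite.equiv (functional A).symm

/-- The canonical isomorphism `A' ⊗ A' ≃ (A ⊗ A)'` for finite-dimensional `A`. -/
def pairing : DualSpace A ⊗[ℂ] DualSpace A ≃ₗ[ℂ] Module.Dual ℂ (A ⊗[ℂ] A) :=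
  (TensorProduct.congr (functional A) (functional A)).trans (TensorProduct.dualDistribEquiv ℂ A A)

@[simp] lemma pairing_tmul (f g : DualSpace A) (x y : A) :
    pairing A (f ⊗ₜ g) (x ⊗ₜ y) = f x * g y := rfl

/-- The canonical isomorphism `A' ⊗ (A' ⊗ A') ≃ (A ⊗ (A ⊗ A))'`. -/
def pairing₃ : DualSpace A ⊗[ℂ] (DualSpace A ⊗[ℂ] DualSpace A) ≃ₗ[ℂ]
    Module.Dual ℂ (A ⊗[ℂ] (A ⊗[ℂ] A)) :=
  (TensorProduct.congr (functional A) (pairing A)).trans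
    (TensorProduct.dualDistribEquiv ℂ A (A ⊗[ℂ] A))

@[simp] lemma pairing₃_tmul (f : DualSpace A) (u : DualSpace A ⊗[ℂ] DualSpace A)
    (x : A) (w : A ⊗[ℂ] A) :
    pairing₃ A (f ⊗ₜ u) (x ⊗ₜ w) = f x * pairing A u w := rfl

/-- The comultiplication of `A'` is adjoint to the multiplication of `A`, and its counit is the
evaluation at the unit of `A`. -/
instance : CoalgebraStruct ℂ (DualSpace A) where
  comul := (pairing A).symm.toLinearMap ∘ₗ (LinearMap.mul' ℂ A).dualMap ∘ₗ
    (functional A).toLinearMap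
  counit := LinearMap.applyₗ (1 : A) ∘ₗ (functional A).toLinearMap

lemma pairing_comul_eq (f : DualSpace A) :
    pairing A (comul (R := ℂ) f) = functional A f ∘ₗ LinearMap.mul' ℂ A := by
  change pairing A ((pairing A).symm _) = _
  rw [LinearEquiv.apply_symm_apply]
  rfl

/-- `(Δ f)(x ⊗ y) = f (x y)`. -/
@[simp] lemma pairing_comul (f : DualSpace A) (x y : A) :
    pairing A (comul (R := ℂ) f) (x ⊗ₜ y) = f (x * y) := by
  simp [pairing_comul_eq, coe_functional]

@[simp] lemma counit_dual (f : DualSpace A) : counit (R := ℂ) f = f 1 := rfl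

lemma pairing₃_lTensor (t : DualSpace A ⊗[ℂ] DualSpace A) (x y z : A) :
    pairing₃ A (comul.lTensor _ t) (x ⊗ₜ (y ⊗ₜ z)) = pairing A t (x ⊗ₜ (y * z)) := by
  induction t with
  | zero => simp
  | add a b ha hb => simp only [map_add, LinearMap.add_apply, ha, hb]
  | tmul f g => simp

lemma pairing₃_assoc (u : DualSpace A ⊗[ℂ] DualSpace A) (g : DualSpace A) (x y z : A) :
    pairing₃ A (TensorProduct.assoc ℂ _ _ _ (u ⊗ₜ g)) (x ⊗ₜ (y ⊗ₜ z)) =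
      pairing A u (x ⊗ₜ y) * g z := by
  induction u with
  | zero => simp
  | add a b ha hb =>
    simp only [TensorProduct.add_tmul, map_add, LinearMap.add_apply, ha, hb, add_mul]
  | tmul f h => simp [mul_assoc]

lemma pairing₃_rTensor (t : DualSpace A ⊗[ℂ] DualSpace A) (x y z : A) :
    pairing₃ A (TensorProduct.assoc ℂ _ _ _ (comul.rTensor _ t)) (x ⊗ₜ (y ⊗ₜ z)) =
      pairing A t ((x * y) ⊗ₜ z) := by
  induction t with
  | zero => simp
  | add a b ha hb => simp only [map_add, LinearMap.add_apply, ha, hb]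
  | tmul f g => simp [pairing₃_assoc]

lemma lid_rTensor (t : DualSpace A ⊗[ℂ] DualSpace A) (y : A) :
    (TensorProduct.lid ℂ _ (counit.rTensor _ t)) y = pairing A t (1 ⊗ₜ y) := by
  induction t with
  | zero => simp
  | add a b ha hb =>
    simp only [map_add, LinearMap.add_apply, dual_add_apply, ha, hb]
  | tmul f g => simp

lemma rid_lTensor (t : DualSpace A ⊗[ℂ] DualSpace A) (y : A) :
    (TensorProduct.rid ℂ _ (counit.lTensor _ t)) y = pairing A t (y ⊗ₜ 1) := by
  induction t with
  | zero => simp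
  | add a b ha hb =>
    simp only [map_add, LinearMap.add_apply, dual_add_apply, ha, hb]
  | tmul f g => simp [mul_comm]

instance : Coalgebra ℂ (DualSpace A) where
  coassoc := by
    refine LinearMap.ext fun f => (pairing₃ A).injective ?_
    ext x y z
    simp [pairing₃_lTensor, pairing₃_rTensor, mul_assoc]
  rTensor_counit_comp_comul := by
    refine LinearMap.ext fun f => (TensorProduct.lid ℂ _).injective ?_
    ext y
    simp [lid_rTensor]
  lTensor_counit_comp_comul := by
    refine LinearMap.ext fun f => (TensorProduct.rid ℂ _).injective ?_
    ext y
    simp [rid_lTensor]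

/-- The pairing is multiplicative for the convolution products. -/
lemma pairing_mul (s t : DualSpace A ⊗[ℂ] DualSpace A) :
    WithConv.toConv (pairing A (s * t)) =
      WithConv.toConv (pairing A s) * WithConv.toConv (pairing A t) := by
  induction s with
  | zero => simp
  | add a b ha hb => simp only [map_add, add_mul, WithConv.toConv_add, ha, hb]
  | tmul f g =>
    induction t with
    | zero => simp
    | add a b ha hb => simp only [map_add, mul_add, WithConv.toConv_add, ha, hb]
    | tmul f₂ g₂ =>
      have key (p q : DualSpace A) : pairing A (p ⊗ₜ q) =
          (Algebra.TensorProduct.lmul' ℂ (S := ℂ)).toLinearMap ∘ₗ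
            TensorProduct.map (functional A p) (functional A q) := by
        ext x y; rfl
      have h := TensorProduct.map_convMul_map (R := ℂ)
        (f := WithConv.toConv (functional A f)) (h := WithConv.toConv (functional A f₂))
        (g := WithConv.toConv (functional A g)) (k := WithConv.toConv (functional A g₂))
      rw [Algebra.TensorProduct.tmul_mul_tmul, key, key, key]
      apply WithConv.ofConv_injective
      rw [← LinearMap.algHom_comp_convMul_distrib
        (f := WithConv.toConv (TensorProduct.map (functional A f) (functional A g)))
        (g := WithConv.toConv (TensorProduct.map (functional A f₂) (functional A g₂)))]
      exact congrArg (fun u => (Algebra.TensorProduct.lmul' ℂ (S := ℂ)).toLinearMap ∘ₗ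
        WithConv.ofConv u) h.symm

/-- The dual of a finite-dimensional bialgebra is a bialgebra. -/
instance : Bialgebra ℂ (DualSpace A) :=
  Bialgebra.mk' ℂ (DualSpace A)
    (by simp)
    (by intro f g; simp [dual_mul_apply, coe_functional, Bialgebra.comul_one,
          Algebra.TensorProduct.one_def])
    (by
      apply (pairing A).injective
      ext x y
      simp [Algebra.TensorProduct.one_def])
    (by
      intro f g
      apply (pairing A).injective
      apply WithConv.toConv_injective
      rw [pairing_mul]
      simp only [pairing_comul_eq]
      exact congrArg WithConv.toConv
        (LinearMap.convMul_comp_coalgHom_distrib (WithConv.toConv (functional A f))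
          (WithConv.toConv (functional A g)) (Bialgebra.mulCoalgHom ℂ A)))

end Dual

/-! ### Involutive bialgebras -/

section Involutive

variable {A : Type*} [Ring A] [Bialgebra ℂ A]

/-- The adjoint of an antilinear operator `φ` on `A`: the antilinear operator on `A'` given by
`(φ' f)(x) = conj (f (φ x))`. -/
def adjoint (φ : A →ₛₗ[starRingEnd ℂ] A) : DualSpace A →ₛₗ[starRingEnd ℂ] DualSpace A where
  toFun f := (functional A).symm
    { toFun := fun x => conj (f (φ x))
      map_add' := fun x y => by simp
      map_smul' := fun c x => by simp }
  map_add' f g := by ext x; simp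
  map_smul' c f := by ext x; simp

/-- An involutive bialgebra: a bialgebra with an involution `sharp` (an antilinear algebra
antiautomorphism of order two) and a coinvolution `flat` (an antilinear coalgebra
antiautomorphism of order two) such that the comultiplication commutes with the involution and the
multiplication commutes with the coinvolution.  (Compatibility of `sharp` and `flat` with the unit
and the counit follows.) -/
structure IsInvolutiveBialgebra (sharp flat : A →ₛₗ[starRingEnd ℂ] A) : Prop where
  sharp_sharp : ∀ x, sharp (sharp x) = x
  sharp_mul : ∀ x y, sharp (x * y) = sharp y * sharp x
  flat_flat : ∀ x, flat (flat x) = x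
  comul_flat : ∀ x, comul (R := ℂ) (flat x) =
    TensorProduct.comm ℂ A A (TensorProduct.map flat flat (comul x))
  comul_sharp : ∀ x, comul (R := ℂ) (sharp x) = TensorProduct.map sharp sharp (comul x)
  flat_mul : ∀ x y, flat (x * y) = flat x * flat y

/-- Semisimplicity of a finite-dimensional involutive bialgebra `A`: the algebra `A` and the dual
algebra `A'` are semisimple, and they are semisimple as algebras with involution, i.e. the
involution of `A` and the involution of `A'` (the adjoint of the coinvolution) are proper
(`x♯ x = 0` only for `x = 0`; in finite dimension this means that the algebra with involution is a
self-adjoint algebra of complex matrices with the usual conjugate transpose). -/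
structure IsSemisimpleInvolutive (sharp flat : A →ₛₗ[starRingEnd ℂ] A) : Prop where
  algebra_semisimple : IsSemisimpleRing A
  coalgebra_semisimple : IsSemisimpleRing (DualSpace A)
  sharp_proper : ∀ x : A, sharp x * x = 0 → x = 0
  flat_proper : ∀ f : DualSpace A, adjoint flat f * f = 0 → f = 0

/-- Isomorphism of involutive bialgebras. -/
def InvolutiveIso {B : Type*} [Ring B] [Bialgebra ℂ B]
    (sharpA flatA : A →ₛₗ[starRingEnd ℂ] A) (sharpB flatB : B →ₛₗ[starRingEnd ℂ] B) : Prop :=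
  ∃ e : A ≃ₐc[ℂ] B, (∀ x, e (sharpA x) = sharpB (e x)) ∧ ∀ x, e (flatA x) = flatB (e x)

end Involutive

/-! ### Inverse semigroups and their semigroup algebras -/

section Semigroup

/-- Inverse semigroup: every element `a` has a unique inverse `b`, i.e. a unique `b` with
`a b a = a` and `b a b = b`. -/
def IsInverseSemigroup (S : Type*) [Semigroup S] : Prop :=
  ∀ a : S, ∃! b : S, a * b * a = a ∧ b * a * b = b

variable {S : Type*} [Monoid S]

/-- The inverse `a*` of an element of an inverse semigroup. -/
def IsInverseSemigroup.inv (h : IsInverseSemigroup S) (a : S) : S := (h a).choose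

/-- The antilinear extension of a map `φ : S → S` to the semigroup algebra:
`∑ c_s s ↦ ∑ conj(c_s) φ(s)`. -/
def antilinearExtension (φ : S → S) :
    MonoidAlgebra ℂ S →ₛₗ[starRingEnd ℂ] MonoidAlgebra ℂ S where
  toFun x := x.coeff.sum fun s c => MonoidAlgebra.single (φ s) (conj c)
  map_add' x y := by
    rw [MonoidAlgebra.coeff_add, Finsupp.sum_add_index'] <;> simp
  map_smul' c x := by
    rw [MonoidAlgebra.coeff_smul, Finsupp.sum_smul_index (by simp), Finsupp.smul_sum]
    simp

/-- The involution of the semigroup algebra of an inverse semigroup: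
`∑ c_s s ↦ ∑ conj(c_s) s*`. -/
def semigroupSharp (h : IsInverseSemigroup S) :
    MonoidAlgebra ℂ S →ₛₗ[starRingEnd ℂ] MonoidAlgebra ℂ S :=
  antilinearExtension h.inv

/-- The coinvolution of a semigroup algebra: `∑ c_s s ↦ ∑ conj(c_s) s`. -/
def semigroupFlat (S : Type*) [Monoid S] :
    MonoidAlgebra ℂ S →ₛₗ[starRingEnd ℂ] MonoidAlgebra ℂ S :=
  antilinearExtension id

end Semigroup

end InvBialg

end

/-! In a finite-dimensional algebra with proper involution, `star s * s` has nonnegative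
eigenvalues; if moreover it has only finitely many powers, then it is a projection and `s` is a
partial isometry. Products of two projections being partial isometries forces the projections to
commute. If `A` is cocommutative and `A'` semisimple, then `A'` is a product of copies of `ℂ`,
whose characters are the group-like elements of `A`; these form a basis of `A`, hence a finite
monoid stable under the involution. So the group-like elements are partial isometries with
commuting projections, that is, they form an inverse monoid, of which `A` is the semigroup algebra;
a group-like element moved by the coinvolution would contradict properness on `A'`.

Conversely, the representation of a finite inverse monoid by partial permutation matrices is
faithful on the semigroup algebra and takes its involution to the conjugate transpose, which is
proper. The commutative case follows by duality. -/

noncomputable section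

namespace InvBialg

open Coalgebra

/-! ### Proper involutions -/

/-- The involution of a star ring is proper if `star x * x = 0` only for `x = 0`.  In finite
dimension over `ℂ` this replaces the norm of a C⋆-algebra. -/
def IsProperStar (A : Type*) [Ring A] [StarRing A] : Prop :=
  ∀ x : A, star x * x = 0 → x = 0

lemma exists_eigenvector_of_commute {K A : Type*} [Field K] [IsAlgClosed K] [Ring A] [Algebra K A]
    [Module.Finite K A] {a d : A} (hd : d ≠ 0) (had : Commute a d) :
    ∃ (z : A) (μ : K), d * z ≠ 0 ∧ a * (d * z) = μ • (d * z) := by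
  let V := LinearMap.range (LinearMap.mulLeft K d)
  have hV : ∀ x ∈ V, LinearMap.mulLeft K a x ∈ V := by
    rintro _ ⟨z, rfl⟩
    exact ⟨a * z, by simp only [LinearMap.mulLeft_apply, ← mul_assoc, had.eq]⟩
  have : Nontrivial V := Submodule.nontrivial_iff_ne_bot.2 fun h =>
    hd (by simpa using (LinearMap.range_eq_bot.1 h ▸ rfl : LinearMap.mulLeft K d 1 = 0))
  obtain ⟨μ, hμ⟩ := Module.End.exists_eigenvalue ((LinearMap.mulLeft K a).restrict hV)
  obtain ⟨⟨_, z, rfl⟩, hv⟩ := hμ.exists_hasEigenvector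
  exact ⟨z, μ, fun h => hv.2 (Subtype.ext h), congrArg Subtype.val hv.apply_eq_smul⟩

namespace IsProperStar

section StarRing

variable {A : Type*} [Ring A] [StarRing A]

lemma eq_zero_of_mul_star_self (hA : IsProperStar A) {x : A} (hx : x * star x = 0) : x = 0 :=
  star_eq_zero.1 (hA (star x) (by rwa [star_star]))

lemma mul_eq_zero_of_star_mul_mul (hA : IsProperStar A) {a w : A} (h : star a * (a * w) = 0) :
    a * w = 0 :=
  hA _ (by rw [star_mul, mul_assoc, h, mul_zero])

lemma eq_zero_of_isNilpotent (hA : IsProperStar A) {a : A} (ha : IsSelfAdjoint a)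
    (hn : IsNilpotent a) : a = 0 := by
  have descent (n : ℕ) (h : a ^ 2 ^ n = 0) : a = 0 := by
    induction n with
    | zero => rwa [pow_zero, pow_one] at h
    | succ n ih =>
      exact ih (hA _ (by rw [(ha.pow _).star_eq, ← pow_add, ← two_mul, ← pow_succ', h]))
  obtain ⟨n, hn⟩ := hn
  exact descent n (pow_eq_zero_of_le n.lt_two_pow_self.le hn)

lemma isSemisimpleRing [IsArtinianRing A] (hA : IsProperStar A) : IsSemisimpleRing A := by
  rw [IsArtinianRing.isSemisimpleRing_iff_jacobson, eq_bot_iff]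
  intro x hx
  obtain ⟨n, hn⟩ := IsArtinianRing.isNilpotent_jacobson_bot (R := A)
  refine hA x (hA.eq_zero_of_isNilpotent (.star_mul_self x) ⟨n, ?_⟩)
  have hmem := Ideal.pow_mem_pow (Ideal.mul_mem_left _ (star x) hx) n
  rwa [← Ideal.jacobson_bot, hn] at hmem

lemma mul_star_mul_self (hA : IsProperStar A) {s : A} (hs : IsIdempotentElem (star s * s)) :
    s * star s * s = s := by
  refine sub_eq_zero.1 (hA _ ?_)
  have hs' : star s * (s * (star s * s)) = star s * s := by rw [← mul_assoc, hs.eq]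
  simp only [star_sub, star_mul, star_star, sub_mul, mul_sub, mul_assoc, hs', sub_self]

lemma commute_of_isStarProjection (hA : IsProperStar A) {e f : A} (he : IsStarProjection e)
    (hf : IsStarProjection f) (hef : e * f * star (e * f) * (e * f) = e * f) : Commute e f := by
  have he' := he.isIdempotentElem.eq
  have hf' := hf.isIdempotentElem.eq
  have hstar : star (e * f) = f * e := by
    rw [star_mul, he.isSelfAdjoint.star_eq, hf.isSelfAdjoint.star_eq]
  have hef' : e * f * e * f = e * f := by
    rw [hstar] at hef
    grind
  have hefe : e * f = e * f * e := by
    refine sub_eq_zero.1 (hA.eq_zero_of_mul_star_self ?_)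
    rw [star_sub, star_mul (e * f), hstar, he.isSelfAdjoint.star_eq]
    have hfefe : e * f * (e * (f * e)) = e * f * e := by rw [← mul_assoc, ← mul_assoc, hef']
    simp only [sub_mul, mul_sub, hfefe]
    grind
  calc e * f = e * f * e := hefe
    _ = star (e * f * e) := by rw [star_mul, hstar, he.isSelfAdjoint.star_eq, mul_assoc]
    _ = f * e := by rw [← hefe, hstar]

end StarRing

section Field

variable {K A : Type*} [Field K] [Ring A] [StarRing A] [Algebra K A]

lemma star_eq_of_isSelfAdjoint [StarRing K] [StarModule K A] (hA : IsProperStar A) {a v : A} {μ : K}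
    (ha : IsSelfAdjoint a) (hv : v ≠ 0) (h : a * v = μ • v) : star μ = μ := by
  have hμ : star μ • (star v * v) = μ • (star v * v) :=
    calc star μ • (star v * v) = star (a * v) * v := by
          rw [h, star_smul, smul_mul_assoc]
      _ = star v * (a * v) := by rw [star_mul, ha.star_eq, mul_assoc]
      _ = μ • (star v * v) := by rw [h, mul_smul_comm]
  exact smul_left_injective K (mt (hA v) hv) hμ

variable (K) [Module.Finite K A]

lemma isCompl_ker_range_mulLeft (hA : IsProperStar A) {a : A} (ha : IsSelfAdjoint a) :
    IsCompl (LinearMap.ker (LinearMap.mulLeft K a)) (LinearMap.range (LinearMap.mulLeft K a)) := by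
  rw [Submodule.isCompl_iff_disjoint _ _
    (by rw [add_comm, LinearMap.finrank_range_add_finrank_ker]), Submodule.disjoint_def]
  rintro _ h ⟨z, rfl⟩
  exact hA.mul_eq_zero_of_star_mul_mul (by rwa [ha.star_eq])

-- `w` is an eigenvector of the compression of `v ↦ s * v` to `ker a`, along `range a`.
lemma exists_star_mul_mul_eq_smul [IsAlgClosed K] (hA : IsProperStar A) {a v : A}
    (ha : IsSelfAdjoint a) (hv : v ≠ 0) (hav : a * v = 0) (s : A) :
    ∃ (w : A) (μ : K), w ≠ 0 ∧ a * w = 0 ∧ star w * (s * w) = μ • (star w * w) := by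
  let N := LinearMap.ker (LinearMap.mulLeft K a)
  let R := LinearMap.range (LinearMap.mulLeft K a)
  have hNR : IsCompl N R := hA.isCompl_ker_range_mulLeft K ha
  have : Nontrivial N := ⟨⟨⟨v, hav⟩, 0, fun h => hv (congrArg Subtype.val h)⟩⟩
  obtain ⟨μ, hμ⟩ := Module.End.exists_eigenvalue
    (N.projectionOnto R hNR ∘ₗ LinearMap.mulLeft K s ∘ₗ N.subtype)
  obtain ⟨⟨w, hw⟩, hv⟩ := hμ.exists_hasEigenvector
  have hwμ : N.projection R hNR (s * w) = μ • w := congrArg Subtype.val hv.apply_eq_smul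
  obtain ⟨z, hz⟩ : s * w - N.projection R hNR (s * w) ∈ R := Submodule.sub_projection_mem hNR _
  have hs : s * w = μ • w + a * z := by rw [← hwμ, ← sub_eq_iff_eq_add', ← hz]; rfl
  have horth : star w * (a * z) = 0 := by
    rw [← mul_assoc, ← ha.star_eq, ← star_mul, show a * w = 0 from hw, star_zero, zero_mul]
  exact ⟨w, μ, fun h => hv.2 (Subtype.ext h), hw, by rw [hs, mul_add, horth, add_zero,
    mul_smul_comm]⟩

end Field

section Complex

variable {A : Type*} [Ring A] [StarRing A] [Algebra ℂ A] [StarModule ℂ A]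

lemma mul_eq_neg_smul_of_quadratic_eq_zero (hA : IsProperStar A) {s w : A} {ν : ℂ} {r t : ℝ}
    (hr : star s * (s * w) = (r : ℂ) • w) (hν : star w * (s * w) = ν • (star w * w))
    (ht : t * t + 2 * ν.re * t + r = 0) : s * w = -(t : ℂ) • w := by
  have hν' : star w * (star s * w) = conj ν • (star w * w) := by
    simpa [mul_assoc] using congrArg star hν
  have hstar : star ((t : ℂ) • w) = (t : ℂ) • star w := by
    rw [star_smul, ← starRingEnd_apply, Complex.conj_ofReal]
  have hcoeff : (r + t * ν + (t * conj ν + t * t) : ℂ) = 0 := by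
    have htc : (t * t + (2 * ν.re : ℝ) * t + r : ℂ) = 0 := by exact_mod_cast ht
    linear_combination htc + t * Complex.add_conj ν
  rw [neg_smul, ← add_eq_zero_iff_eq_neg]
  refine hA _ ?_
  calc star (s * w + (t : ℂ) • w) * (s * w + (t : ℂ) • w)
      = (r + t * ν + (t * conj ν + t * t) : ℂ) • (star w * w) := by
        simp only [star_add, star_mul, hstar, add_mul, mul_add, smul_mul_assoc, mul_smul_comm,
          mul_assoc, hr, hν, hν', smul_smul, add_smul, smul_add]
    _ = 0 := by rw [hcoeff, zero_smul]

-- A negative eigenvalue `r` of `star s * s` allows `x = s * w + t • w ≠ 0` with `star x * x = 0`.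
lemma exists_nonneg_eq_of_eigenvalue_star_mul_self [Module.Finite ℂ A] (hA : IsProperStar A)
    {s v : A} {μ : ℂ} (hv : v ≠ 0) (h : star s * s * v = μ • v) :
    ∃ r : ℝ, 0 ≤ r ∧ (r : ℂ) = μ := by
  obtain ⟨r, rfl⟩ := Complex.conj_eq_iff_real.1
    (hA.star_eq_of_isSelfAdjoint (.star_mul_self s) hv h)
  refine ⟨r, ?_, rfl⟩
  by_contra! hr
  obtain ⟨w, ν, hw, hrw, hν⟩ := hA.exists_star_mul_mul_eq_smul ℂ
    (a := star s * s - algebraMap ℂ A r)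
    (.sub (.star_mul_self s) (.algebraMap A (Complex.conj_ofReal r))) hv
    (by rw [sub_mul, h, Algebra.smul_def, sub_self]) s
  rw [sub_mul, sub_eq_zero, mul_assoc, ← Algebra.smul_def] at hrw
  obtain ⟨t, ht, htr⟩ : ∃ t : ℝ, t * t + 2 * ν.re * t + r = 0 ∧ t * t ≠ r :=
    ⟨-ν.re + √(ν.re ^ 2 - r),
      by linear_combination Real.sq_sqrt (by nlinarith : 0 ≤ ν.re ^ 2 - r),
      (hr.trans_le (mul_self_nonneg _)).ne'⟩
  have hsw := hA.mul_eq_neg_smul_of_quadratic_eq_zero hrw hν ht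
  have htt : ((t * t : ℝ) : ℂ) • (star w * w) = (r : ℂ) • (star w * w) :=
    calc ((t * t : ℝ) : ℂ) • (star w * w) = star (s * w) * (s * w) := by
          rw [hsw, star_smul, smul_mul_smul_comm]
          simp
      _ = (r : ℂ) • (star w * w) := by rw [star_mul, mul_assoc, hrw, mul_smul_comm]
  exact htr (Complex.ofReal_injective (smul_left_injective ℂ (mt (hA w) hw) htt))

lemma isIdempotentElem_star_mul_self [Module.Finite ℂ A] (hA : IsProperStar A) {s : A} {m n : ℕ}
    (hmn : m ≠ n) (h : (star s * s) ^ m = (star s * s) ^ n) : IsIdempotentElem (star s * s) := by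
  by_contra hidem
  have ha : IsSelfAdjoint (star s * s) := .star_mul_self s
  set a := star s * s
  obtain ⟨z, μ, hz, hμ⟩ := exists_eigenvector_of_commute (K := ℂ) (sub_ne_zero.2 hidem)
    (((Commute.refl a).mul_right (.refl a)).sub_right (.refl a))
  obtain ⟨r, hr, rfl⟩ := hA.exists_nonneg_eq_of_eigenvalue_star_mul_self hz hμ
  set d := a * a - a
  have hpow (k : ℕ) : a ^ k * (d * z) = (r : ℂ) ^ k • (d * z) := by
    induction k with
    | zero => rw [pow_zero, pow_zero, one_mul, one_smul]
    | succ k ih => rw [pow_succ, mul_assoc, hμ, mul_smul_comm, ih, smul_smul, pow_succ']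
  have hrmn : r ^ m = r ^ n := by
    exact_mod_cast smul_left_injective ℂ hz ((hpow m).symm.trans (h ▸ hpow n))
  have hrr : r * r = r := by
    rcases hr.eq_or_lt with rfl | hr
    · exact mul_zero 0
    · by_cases hr1 : r = 1
      · rw [hr1, mul_one]
      · exact absurd (pow_right_injective₀ hr hr1 hrmn) hmn
  have hd : IsSelfAdjoint d := (pow_two a ▸ ha.pow 2).sub ha
  refine hz (hA.mul_eq_zero_of_star_mul_mul ?_)
  rw [hd.star_eq, sub_mul, mul_assoc, hμ, mul_smul_comm, hμ, smul_smul]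
  rw [← sub_smul, ← Complex.ofReal_mul, hrr, sub_self, zero_smul]

end Complex

end IsProperStar

/-! ### Duality of involutive bialgebras -/

section Duality

variable {A B : Type*} [Ring A] [Bialgebra ℂ A] [Ring B] [Bialgebra ℂ B]

lemma adjoint_apply (φ : A →ₛₗ[starRingEnd ℂ] A) (f : DualSpace A) (x : A) :
    adjoint φ f x = conj (f (φ x)) := rfl

lemma adjoint_adjoint {φ : A →ₛₗ[starRingEnd ℂ] A} (hφ : ∀ x, φ (φ x) = x) (f : DualSpace A) :
    adjoint φ (adjoint φ f) = f := by
  ext x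
  rw [adjoint_apply, adjoint_apply, hφ, Complex.conj_conj]

lemma dual_mul_comm [IsCocomm ℂ A] (f g : DualSpace A) : f * g = g * f :=
  mul_comm (G := WithConv (A →ₗ[ℂ] ℂ)) f g

/-- The transpose of a bialgebra isomorphism, as a linear isomorphism of the dual spaces. -/
def transposeLinearEquiv (e : A ≃ₐc[ℂ] B) : DualSpace B ≃ₗ[ℂ] DualSpace A :=
  (functional B).trans (e.toCoalgEquiv.toLinearEquiv.dualMap.trans (functional A).symm)

@[simp] lemma transposeLinearEquiv_apply (e : A ≃ₐc[ℂ] B) (f : DualSpace B) (x : A) :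
    transposeLinearEquiv e f x = f (e x) := rfl

variable (A) in
/-- The canonical linear isomorphism of `A` with its second dual. -/
def bidualLinearEquiv [Module.Finite ℂ A] : A ≃ₗ[ℂ] DualSpace (DualSpace A) :=
  (Module.evalEquiv ℂ A).trans ((functional A).dualMap.trans (functional (DualSpace A)).symm)

@[simp] lemma bidualLinearEquiv_apply [Module.Finite ℂ A] (x : A) (f : DualSpace A) :
    bidualLinearEquiv A x f = f x := rfl

section Pairing

variable [Module.Finite ℂ A] [Module.Finite ℂ B]

lemma dual_mul_apply_eq_pairing (f g : DualSpace A) (x : A) :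
    (f * g) x = pairing A (f ⊗ₜ g) (comul (R := ℂ) x) := rfl

lemma pairing_map_adjoint (φ : A →ₛₗ[starRingEnd ℂ] A) (u : DualSpace A ⊗[ℂ] DualSpace A)
    (t : A ⊗[ℂ] A) :
    pairing A (TensorProduct.map (adjoint φ) (adjoint φ) u) t =
      conj (pairing A u (TensorProduct.map φ φ t)) := by
  induction u with
  | zero => simp
  | add u v hu hv => simp only [map_add, LinearMap.add_apply, hu, hv]
  | tmul f g =>
    induction t with
    | zero => simp
    | add s t hs ht => simp only [map_add, hs, ht]
    | tmul x y => simp [adjoint_apply]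

lemma pairing_comm (u : DualSpace A ⊗[ℂ] DualSpace A) (t : A ⊗[ℂ] A) :
    pairing A (TensorProduct.comm ℂ _ _ u) t = pairing A u (TensorProduct.comm ℂ _ _ t) := by
  induction u with
  | zero => simp
  | add u v hu hv => simp only [map_add, LinearMap.add_apply, hu, hv]
  | tmul f g =>
    induction t with
    | zero => simp
    | add s t hs ht => simp only [map_add, hs, ht]
    | tmul x y => simp [mul_comm]

lemma pairing_map_bidual (t : A ⊗[ℂ] A) (u : DualSpace A ⊗[ℂ] DualSpace A) :
    pairing (DualSpace A) (TensorProduct.map (bidualLinearEquiv A).toLinearMap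
      (bidualLinearEquiv A).toLinearMap t) u = pairing A u t := by
  induction u with
  | zero => simp
  | add u v hu hv => simp only [map_add, LinearMap.add_apply, hu, hv]
  | tmul f g =>
    induction t with
    | zero => simp
    | add s t hs ht => simp only [map_add, LinearMap.add_apply, hs, ht]
    | tmul x y => simp

lemma pairing_map_transpose (e : A ≃ₐc[ℂ] B) (u : DualSpace B ⊗[ℂ] DualSpace B) (t : A ⊗[ℂ] A) :
    pairing A (TensorProduct.map (transposeLinearEquiv e).toLinearMap
      (transposeLinearEquiv e).toLinearMap u) t =
      pairing B u (TensorProduct.map (e : A →ₗ[ℂ] B) (e : A →ₗ[ℂ] B) t) := by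
  induction u with
  | zero => simp
  | add u v hu hv => simp only [map_add, LinearMap.add_apply, hu, hv]
  | tmul f g =>
    induction t with
    | zero => simp
    | add s t hs ht => simp only [map_add, hs, ht]
    | tmul x y => simp

end Pairing

variable [Module.Finite ℂ A]

lemma IsInvolutiveBialgebra.dual {sharp flat : A →ₛₗ[starRingEnd ℂ] A}
    (h : IsInvolutiveBialgebra sharp flat) :
    IsInvolutiveBialgebra (adjoint flat) (adjoint sharp) where
  sharp_sharp := adjoint_adjoint h.flat_flat
  flat_flat := adjoint_adjoint h.sharp_sharp
  sharp_mul f g := by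
    ext x
    rw [adjoint_apply, dual_mul_apply_eq_pairing, dual_mul_apply_eq_pairing, h.comul_flat,
      ← pairing_comm, ← pairing_map_adjoint]
    simp
  flat_mul f g := by
    ext x
    rw [adjoint_apply, dual_mul_apply_eq_pairing, dual_mul_apply_eq_pairing, h.comul_sharp,
      ← pairing_map_adjoint, TensorProduct.map_tmul]
  comul_flat f := by
    apply (pairing A).injective
    ext x y
    simp [pairing_comm, pairing_map_adjoint, adjoint_apply, h.sharp_mul]
  comul_sharp f := by
    apply (pairing A).injective
    ext x y
    simp [pairing_map_adjoint, adjoint_apply, h.flat_mul]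

lemma isCocomm_dual (h : ∀ x y : A, x * y = y * x) : IsCocomm ℂ (DualSpace A) where
  comm_comp_comul := by
    refine LinearMap.ext fun f => (pairing A).injective ?_
    ext x y
    simp [pairing_comm, h x y]

variable (A) in
/-- The canonical isomorphism of the bialgebra `A` with its second dual. -/
def bidual : A ≃ₐc[ℂ] DualSpace (DualSpace A) where
  __ := bidualLinearEquiv A
  counit_comp := by ext x; simp
  map_comp_comul := by
    refine LinearMap.ext fun x => (pairing (DualSpace A)).injective ?_
    ext f g
    simpa [dual_mul_apply_eq_pairing] using pairing_map_bidual (comul (R := ℂ) x) (f ⊗ₜ g)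
  map_mul' x y := by
    ext f
    simpa [dual_mul_apply_eq_pairing] using
      (pairing_map_bidual (x ⊗ₜ y) (comul (R := ℂ) f)).symm

@[simp] lemma bidual_apply (x : A) (f : DualSpace A) : bidual A x f = f x := rfl

lemma bidual_antilinear (φ : A →ₛₗ[starRingEnd ℂ] A) (x : A) :
    bidual A (φ x) = adjoint (adjoint φ) (bidual A x) := by
  ext f
  simp [adjoint_apply]

lemma IsSemisimpleInvolutive.dual {sharp flat : A →ₛₗ[starRingEnd ℂ] A}
    (h : IsSemisimpleInvolutive sharp flat) :
    IsSemisimpleInvolutive (adjoint flat) (adjoint sharp) where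
  algebra_semisimple := h.coalgebra_semisimple
  coalgebra_semisimple :=
    (RingEquiv.isSemisimpleRing_iff (bidual A : A ≃+* DualSpace (DualSpace A))).1
      h.algebra_semisimple
  sharp_proper := h.flat_proper
  flat_proper F hF := by
    obtain ⟨x, rfl⟩ := EquivLike.surjective (bidual A) F
    rw [← bidual_antilinear, ← map_mul, EmbeddingLike.map_eq_zero_iff] at hF
    rw [h.sharp_proper x hF, map_zero]

variable [Module.Finite ℂ B]

/-- The transpose of a bialgebra isomorphism, as an isomorphism of the dual bialgebras. -/
def transpose (e : A ≃ₐc[ℂ] B) : DualSpace B ≃ₐc[ℂ] DualSpace A where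
  __ := transposeLinearEquiv e
  counit_comp := by ext f; simp
  map_comp_comul := by
    refine LinearMap.ext fun f => (pairing A).injective ?_
    ext x y
    simpa using pairing_map_transpose e (comul (R := ℂ) f) (x ⊗ₜ y)
  map_mul' f g := by
    ext x
    have he : TensorProduct.map (e : A →ₗ[ℂ] B) (e : A →ₗ[ℂ] B) (comul x) = comul (e x) :=
      CoalgHomClass.map_comp_comul_apply e x
    simpa [dual_mul_apply_eq_pairing, he] using (pairing_map_transpose e (f ⊗ₜ g) (comul x)).symm

@[simp] lemma transpose_apply (e : A ≃ₐc[ℂ] B) (f : DualSpace B) (x : A) :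
    transpose e f x = f (e x) := rfl

lemma transpose_bidual_antilinear {e : DualSpace A ≃ₐc[ℂ] B} {φ : A →ₛₗ[starRingEnd ℂ] A}
    {ψ : B →ₛₗ[starRingEnd ℂ] B} (h : ∀ f, e (adjoint φ f) = ψ (e f)) (x : A) :
    transpose e.symm (bidual A (φ x)) = adjoint ψ (transpose e.symm (bidual A x)) := by
  ext b
  obtain ⟨f, rfl⟩ := EquivLike.surjective e b
  rw [adjoint_apply, ← h]
  simp [adjoint_apply]

lemma InvolutiveIso.of_dual {sharp flat : A →ₛₗ[starRingEnd ℂ] A}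
    {sharpB flatB : B →ₛₗ[starRingEnd ℂ] B}
    (h : InvolutiveIso (adjoint flat) (adjoint sharp) sharpB flatB) :
    InvolutiveIso sharp flat (adjoint flatB) (adjoint sharpB) := by
  obtain ⟨e, hflat, hsharp⟩ := h
  exact ⟨(bidual A).trans (transpose e.symm), transpose_bidual_antilinear hsharp,
    transpose_bidual_antilinear hflat⟩

end Duality

/-! ### Inverse monoids -/

namespace IsInverseSemigroup

variable {S : Type*} [Monoid S] (hS : IsInverseSemigroup S)
include hS

lemma mul_inv_mul (a : S) : a * hS.inv a * a = a := (hS a).choose_spec.1.1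

lemma inv_mul_inv (a : S) : hS.inv a * a * hS.inv a = hS.inv a := (hS a).choose_spec.1.2

lemma eq_inv {a b : S} (h₁ : a * b * a = a) (h₂ : b * a * b = b) : b = hS.inv a :=
  (hS a).choose_spec.2 b ⟨h₁, h₂⟩

lemma inv_inv (a : S) : hS.inv (hS.inv a) = a :=
  (hS.eq_inv (hS.inv_mul_inv a) (hS.mul_inv_mul a)).symm

lemma inv_of_isIdempotentElem {e : S} (he : IsIdempotentElem e) : hS.inv e = e :=
  (hS.eq_inv (by rw [he.eq, he.eq]) (by rw [he.eq, he.eq])).symm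

lemma isIdempotentElem_inv_mul_self (a : S) : IsIdempotentElem (hS.inv a * a) := by
  rw [IsIdempotentElem, ← mul_assoc, hS.inv_mul_inv]

lemma isIdempotentElem_mul_inv_self (a : S) : IsIdempotentElem (a * hS.inv a) := by
  rw [IsIdempotentElem, ← mul_assoc, hS.mul_inv_mul]

-- With `x` the inverse of `e * f`, also `f * x * e` is one; hence `x` is idempotent, and so is
-- `e * f`, the inverse of `x`.
lemma isIdempotentElem_mul {e f : S} (he : IsIdempotentElem e) (hf : IsIdempotentElem f) :
    IsIdempotentElem (e * f) := by
  set x := hS.inv (e * f) with hx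
  have h₁ : e * f * x * (e * f) = e * f := hS.mul_inv_mul (e * f)
  have h₂ : x * (e * f) * x = x := hS.inv_mul_inv (e * f)
  have hfxe : f * x * e = x := by
    refine hS.eq_inv ?_ ?_
    · calc e * f * (f * x * e) * (e * f) = e * (f * f) * x * (e * e) * f := by
            simp only [mul_assoc]
        _ = e * f := by rw [he.eq, hf.eq, mul_assoc _ e, h₁]
    · calc f * x * e * (e * f) * (f * x * e) = f * (x * (e * e) * (f * f) * x) * e := by
            simp only [mul_assoc]
        _ = f * x * e := by rw [he.eq, hf.eq, mul_assoc x, h₂]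
  have hxx : IsIdempotentElem x :=
    calc x * x = f * (x * (e * f) * x) * e := by
          nth_rewrite 1 2 [← hfxe]
          simp only [mul_assoc]
      _ = x := by rw [h₂, hfxe]
  rwa [← hS.inv_inv (e * f), ← hx, hS.inv_of_isIdempotentElem hxx]

lemma commute_of_isIdempotentElem {e f : S} (he : IsIdempotentElem e) (hf : IsIdempotentElem f) :
    Commute e f := by
  have hinv {e f : S} (he : IsIdempotentElem e) (hf : IsIdempotentElem f) :
      e * f * (f * e) * (e * f) = e * f :=
    calc e * f * (f * e) * (e * f) = e * (f * f) * (e * e) * f := by simp only [mul_assoc]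
      _ = e * f * (e * f) := by rw [he.eq, hf.eq, mul_assoc]
      _ = e * f := hS.isIdempotentElem_mul he hf
  have h := hS.eq_inv (hinv he hf) (hinv hf he)
  rwa [hS.inv_of_isIdempotentElem (hS.isIdempotentElem_mul he hf), eq_comm] at h

lemma inv_mul_mul_inv_comm (a b : S) :
    hS.inv a * a * (b * hS.inv b) = b * hS.inv b * (hS.inv a * a) :=
  hS.commute_of_isIdempotentElem (hS.isIdempotentElem_inv_mul_self a)
    (hS.isIdempotentElem_mul_inv_self b)

lemma inv_mul (a b : S) : hS.inv (a * b) = hS.inv b * hS.inv a := by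
  symm
  apply hS.eq_inv
  · calc a * b * (hS.inv b * hS.inv a) * (a * b)
        = a * (b * hS.inv b * (hS.inv a * a)) * b := by simp only [mul_assoc]
      _ = (a * hS.inv a * a) * (b * hS.inv b * b) := by
        rw [← hS.inv_mul_mul_inv_comm]; simp only [mul_assoc]
      _ = a * b := by rw [hS.mul_inv_mul, hS.mul_inv_mul]
  · calc hS.inv b * hS.inv a * (a * b) * (hS.inv b * hS.inv a)
        = hS.inv b * (hS.inv a * a * (b * hS.inv b)) * hS.inv a := by simp only [mul_assoc]
      _ = (hS.inv b * b * hS.inv b) * (hS.inv a * a * hS.inv a) := by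
        rw [hS.inv_mul_mul_inv_comm]; simp only [mul_assoc]
      _ = hS.inv b * hS.inv a := by rw [hS.inv_mul_inv, hS.inv_mul_inv]

lemma mul_inv_mul_mul_inv_of_mul_inv_mul_eq {a b : S} (h : a * hS.inv a * b = a) :
    a * hS.inv a * (b * hS.inv b) = a * hS.inv a := by
  have hcomm : a * hS.inv a * (b * hS.inv b) = b * hS.inv b * (a * hS.inv a) :=
    hS.commute_of_isIdempotentElem (hS.isIdempotentElem_mul_inv_self a)
      (hS.isIdempotentElem_mul_inv_self b)
  have hba : b * hS.inv b * a = a :=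
    calc b * hS.inv b * a = b * hS.inv b * (a * hS.inv a) * b := by rw [mul_assoc _ _ b, h]
      _ = a * hS.inv a * (b * hS.inv b * b) := by rw [← hcomm, mul_assoc]
      _ = a := by rw [hS.mul_inv_mul, h]
  rw [hcomm, ← mul_assoc, hba]

/-- The natural partial order of an inverse monoid: `a ≤ b` if `a` is a restriction of `b`, in
terms of the idempotent `a * inv a`. -/
@[reducible] def naturalOrder : PartialOrder S where
  le a b := a * hS.inv a * b = a
  le_refl := hS.mul_inv_mul
  le_trans a b c hab hbc :=
    calc a * hS.inv a * c = a * hS.inv a * (b * hS.inv b * c) := by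
          rw [← mul_assoc _ (b * _), hS.mul_inv_mul_mul_inv_of_mul_inv_mul_eq hab]
      _ = a := by rw [hbc, hab]
  le_antisymm a b hab hba :=
    calc a = a * hS.inv a * (b * hS.inv b) * b := by rw [mul_assoc, hS.mul_inv_mul, hab]
      _ = b * hS.inv b * (a * hS.inv a) * b := by
        rw [(hS.commute_of_isIdempotentElem (hS.isIdempotentElem_mul_inv_self a)
          (hS.isIdempotentElem_mul_inv_self b)).eq]
      _ = b := by rw [hS.mul_inv_mul_mul_inv_of_mul_inv_mul_eq hba, hS.mul_inv_mul]

open Classical in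
/-- The Wagner–Preston representation: right translation `t ↦ t * s` as a partial bijection, with
partial inverse the right translation by `inv s`. -/
def translation (s : S) : S ≃. S where
  toFun t := if t * s * hS.inv s = t then some (t * s) else none
  invFun u := if u * hS.inv s * s = u then some (u * hS.inv s) else none
  inv t u := by
    simp only [Option.ite_none_right_eq_some, Option.some_inj]
    grind

open Classical in
lemma mem_translation {s t u : S} : u ∈ hS.translation s t ↔ t * s = u ∧ u * hS.inv s = t := by
  change (if t * s * hS.inv s = t then some (t * s) else none) = some u ↔ _
  grind

lemma translation_one : hS.translation 1 = PEquiv.refl S := by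
  ext t u
  rw [← Option.mem_def, ← Option.mem_def, mem_translation,
    hS.inv_of_isIdempotentElem IsIdempotentElem.one, mul_one, mul_one, PEquiv.refl_apply,
    Option.mem_some_iff, eq_comm (a := u), and_self]

lemma translation_mul (a b : S) :
    hS.translation (a * b) = (hS.translation a).trans (hS.translation b) := by
  ext t u
  simp only [← Option.mem_def, PEquiv.mem_trans, mem_translation, hS.inv_mul, ← mul_assoc]
  constructor
  · rintro ⟨rfl, ht⟩
    have hta : t * a * hS.inv a = t :=
      calc t * a * hS.inv a = t * a * b * hS.inv b * (hS.inv a * a * hS.inv a) := by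
            simp only [← mul_assoc, ht]
        _ = t := by rw [hS.inv_mul_inv, ht]
    have htb : t * a * b * hS.inv b = t * a :=
      calc t * a * b * hS.inv b = t * (a * hS.inv a * a) * (b * hS.inv b) := by
            simp only [hS.mul_inv_mul, mul_assoc]
        _ = t * a * (hS.inv a * a * (b * hS.inv b)) := by simp only [mul_assoc]
        _ = t * a * b * hS.inv b * hS.inv a * a := by
          rw [hS.inv_mul_mul_inv_comm]; simp only [mul_assoc]
        _ = t * a := by rw [ht]
    exact ⟨t * a, ⟨rfl, hta⟩, rfl, htb⟩
  · rintro ⟨_, ⟨rfl, ht⟩, rfl, hw⟩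
    exact ⟨rfl, by rw [hw, ht]⟩

/-- The right regular representation of an inverse monoid by partial permutation matrices. -/
def regularRep (R : Type*) [Semiring R] [Fintype S] [DecidableEq S] : S →* Matrix S S R where
  toFun s := (hS.translation s).toMatrix
  map_one' := by rw [translation_one, PEquiv.toMatrix_refl]
  map_mul' a b := by rw [translation_mul, PEquiv.toMatrix_trans]

open Classical in
lemma regularRep_apply (R : Type*) [Semiring R] [Fintype S] [DecidableEq S] (s t u : S) :
    hS.regularRep R s t u = if t * s = u ∧ u * hS.inv s = t then 1 else 0 := by
  simp only [regularRep, MonoidHom.coe_mk, OneHom.coe_mk, PEquiv.toMatrix_apply, mem_translation]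

lemma regularRep_inv (R : Type*) [Semiring R] [StarRing R] [Fintype S] [DecidableEq S] (s : S) :
    hS.regularRep R (hS.inv s) = (hS.regularRep R s).conjTranspose := by
  ext t u
  simp only [Matrix.conjTranspose_apply, regularRep_apply, hS.inv_inv, apply_ite star, star_one,
    star_zero, and_comm]

-- The entry `(s * inv s, s)` of the image of `r` is nonzero only for `s ≤ r`; for `s` maximal in
-- the support of `x`, this entry of the image of `x` is therefore the coefficient of `s`.
lemma lift_regularRep_injective (R : Type*) [CommRing R] [Fintype S] [DecidableEq S] :
    Function.Injective (MonoidAlgebra.lift R (Matrix S S R) S (hS.regularRep R)) := by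
  rw [injective_iff_map_eq_zero]
  intro x hx
  by_contra hx0
  let _ := hS.naturalOrder
  obtain ⟨s, hs⟩ := x.coeff.support.exists_maximal
    (Finsupp.support_nonempty_iff.2 fun h => hx0 (by ext s; simp [h]))
  have hentry : x.coeff.sum (fun r c => c * hS.regularRep R r (s * hS.inv s) s) = x.coeff s := by
    rw [Finsupp.sum, Finset.sum_eq_single_of_mem s hs.1]
    · simp only [regularRep_apply, hS.mul_inv_mul, and_self, if_true, mul_one]
    · intro r hr hrs
      rw [regularRep_apply, if_neg, mul_zero]
      rintro ⟨hsr : s ≤ r, -⟩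
      exact hrs (le_antisymm (hs.2 hr hsr) hsr)
  refine Finsupp.mem_support_iff.1 hs.1 (hentry.symm.trans ?_)
  simpa only [MonoidAlgebra.lift_apply, Finsupp.sum, Matrix.sum_apply, Matrix.smul_apply,
    smul_eq_mul, Matrix.zero_apply] using congrFun₂ hx (s * hS.inv s) s

end IsInverseSemigroup

section Semisimplicity

variable {A : Type*} [Ring A] [Bialgebra ℂ A] {sharp flat : A →ₛₗ[starRingEnd ℂ] A}

/-- The involution of an involutive bialgebra as a star operation on its algebra. -/
@[reducible] def IsInvolutiveBialgebra.starRing (h : IsInvolutiveBialgebra sharp flat) :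
    StarRing A where
  star := sharp
  star_involutive := h.sharp_sharp
  star_mul := h.sharp_mul
  star_add := map_add sharp

lemma IsInvolutiveBialgebra.isSemisimpleRing [IsArtinianRing A]
    (h : IsInvolutiveBialgebra sharp flat) (hsharp : ∀ x, sharp x * x = 0 → x = 0) :
    IsSemisimpleRing A := by
  let _ := h.starRing
  exact IsProperStar.isSemisimpleRing hsharp

lemma IsInvolutiveBialgebra.isSemisimpleInvolutive [Module.Finite ℂ A]
    (h : IsInvolutiveBialgebra sharp flat) (hsharp : ∀ x, sharp x * x = 0 → x = 0)
    (hflat : ∀ f, adjoint flat f * f = 0 → f = 0) : IsSemisimpleInvolutive sharp flat where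
  algebra_semisimple :=
    have := IsArtinianRing.of_finite ℂ A
    h.isSemisimpleRing hsharp
  coalgebra_semisimple :=
    have := IsArtinianRing.of_finite ℂ (DualSpace A)
    h.dual.isSemisimpleRing hflat
  sharp_proper := hsharp
  flat_proper := hflat

lemma dual_mul_apply_of_isGroupLikeElem (f g : DualSpace A) {x : A} (hx : IsGroupLikeElem ℂ x) :
    (f * g) x = f x * g x := by
  rw [dual_mul_apply, hx.comul_eq_tmul_self, TensorProduct.map_tmul, LinearMap.mul'_apply,
    coe_functional, coe_functional]

end Semisimplicity

/-! ### The semigroup algebra of a finite inverse monoid -/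

section SemigroupAlgebra

variable {S : Type*}

@[simp] lemma antilinearExtension_single (φ : S → S) (s : S) (c : ℂ) :
    antilinearExtension φ (MonoidAlgebra.single s c) = MonoidAlgebra.single (φ s) (conj c) := by
  simp [antilinearExtension]

lemma antilinearExtension_involutive {φ : S → S} (hφ : ∀ s, φ (φ s) = s) (x : MonoidAlgebra ℂ S) :
    antilinearExtension φ (antilinearExtension φ x) = x := by
  induction x using MonoidAlgebra.induction_linear with
  | zero => simp
  | add a b ha hb => simp only [map_add, ha, hb]
  | single s c => simp [hφ]

lemma comul_antilinearExtension (φ : S → S) (x : MonoidAlgebra ℂ S) :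
    comul (R := ℂ) (antilinearExtension φ x) =
      TensorProduct.map (antilinearExtension φ) (antilinearExtension φ) (comul x) := by
  induction x using MonoidAlgebra.induction_linear with
  | zero => simp
  | add a b ha hb => simp only [map_add, ha, hb]
  | single s c => simp

variable [Monoid S]

lemma antilinearExtension_mul {φ : S → S} (hφ : ∀ s t, φ (s * t) = φ s * φ t)
    (x y : MonoidAlgebra ℂ S) :
    antilinearExtension φ (x * y) = antilinearExtension φ x * antilinearExtension φ y := by
  induction x using MonoidAlgebra.induction_linear with
  | zero => simp
  | add a b ha hb => simp only [add_mul, map_add, ha, hb]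
  | single s c =>
    induction y using MonoidAlgebra.induction_linear with
    | zero => simp
    | add a b ha hb => simp only [mul_add, map_add, ha, hb]
    | single t d => simp [MonoidAlgebra.single_mul_single, hφ]

lemma antilinearExtension_mul_rev {φ : S → S} (hφ : ∀ s t, φ (s * t) = φ t * φ s)
    (x y : MonoidAlgebra ℂ S) :
    antilinearExtension φ (x * y) = antilinearExtension φ y * antilinearExtension φ x := by
  induction x using MonoidAlgebra.induction_linear with
  | zero => simp
  | add a b ha hb => simp only [add_mul, mul_add, map_add, ha, hb]
  | single s c =>
    induction y using MonoidAlgebra.induction_linear with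
    | zero => simp
    | add a b ha hb => simp only [mul_add, add_mul, map_add, ha, hb]
    | single t d => simp [MonoidAlgebra.single_mul_single, hφ, mul_comm]

lemma isInvolutiveBialgebra_semigroupAlgebra (hS : IsInverseSemigroup S) :
    IsInvolutiveBialgebra (semigroupSharp hS) (semigroupFlat S) where
  sharp_sharp := antilinearExtension_involutive hS.inv_inv
  sharp_mul := antilinearExtension_mul_rev hS.inv_mul
  flat_flat := antilinearExtension_involutive fun _ => rfl
  comul_flat x := by
    rw [semigroupFlat, ← comul_antilinearExtension, Coalgebra.comm_comul]
  comul_sharp := comul_antilinearExtension _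
  flat_mul := antilinearExtension_mul fun _ _ => rfl

lemma lift_regularRep_semigroupSharp [Fintype S] [DecidableEq S] (hS : IsInverseSemigroup S)
    (x : MonoidAlgebra ℂ S) :
    MonoidAlgebra.lift ℂ (Matrix S S ℂ) S (hS.regularRep ℂ) (semigroupSharp hS x) =
      (MonoidAlgebra.lift ℂ (Matrix S S ℂ) S (hS.regularRep ℂ) x).conjTranspose := by
  induction x using MonoidAlgebra.induction_linear with
  | zero => simp
  | add a b ha hb => simp only [map_add, Matrix.conjTranspose_add, ha, hb]
  | single s c => simp [semigroupSharp, MonoidAlgebra.lift_single, hS.regularRep_inv]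

open scoped ComplexOrder in
lemma semigroupSharp_proper [Finite S] (hS : IsInverseSemigroup S) (x : MonoidAlgebra ℂ S)
    (hx : semigroupSharp hS x * x = 0) : x = 0 := by
  classical
  have := Fintype.ofFinite S
  apply hS.lift_regularRep_injective ℂ
  rw [map_zero, ← Matrix.conjTranspose_mul_self_eq_zero, ← lift_regularRep_semigroupSharp,
    ← map_mul, hx, map_zero]

lemma semigroupFlat_proper (f : DualSpace (MonoidAlgebra ℂ S))
    (hf : adjoint (semigroupFlat S) f * f = 0) : f = 0 := by
  have hfs (s : S) : f (MonoidAlgebra.single s 1) = 0 := by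
    have h : (adjoint (semigroupFlat S) f * f) (MonoidAlgebra.single s 1) = 0 := by
      rw [hf, dual_zero_apply]
    rw [dual_mul_apply_of_isGroupLikeElem _ _ (MonoidAlgebra.isGroupLikeElem_single_one s)] at h
    simpa [adjoint_apply, semigroupFlat] using h
  apply (functional _).injective
  ext s
  simpa [coe_functional] using hfs s

lemma isSemisimpleInvolutive_semigroupAlgebra [Finite S] (hS : IsInverseSemigroup S) :
    IsSemisimpleInvolutive (semigroupSharp hS) (semigroupFlat S) :=
  (isInvolutiveBialgebra_semigroupAlgebra hS).isSemisimpleInvolutive (semigroupSharp_proper hS)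
    semigroupFlat_proper

end SemigroupAlgebra

/-! ### Group-like elements -/

lemma isGroupLikeElem_of_comul_eq {K C : Type*} [Field K] [AddCommGroup C] [Module K C]
    [Coalgebra K C] {x : C} (hx : x ≠ 0) (h : comul (R := K) x = x ⊗ₜ[K] x) :
    IsGroupLikeElem K x where
  comul_eq_tmul_self := h
  counit_eq_one := by
    have hcounit := congrArg (TensorProduct.lid K C) (rTensor_counit_comul (R := K) x)
    rw [h, LinearMap.rTensor_tmul, TensorProduct.lid_tmul, TensorProduct.lid_tmul] at hcounit
    exact smul_left_injective K hx hcounit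

lemma eq_zero_of_forall_algHom_eq_zero {K R : Type*} [Field K] [IsAlgClosed K] [CommRing R]
    [Algebra K R] [Algebra.IsIntegral K R] [IsReduced R] {x : R} (hx : ∀ φ : R →ₐ[K] K, φ x = 0) :
    x = 0 := by
  refine IsNilpotent.eq_zero (nilpotent_iff_mem_prime.2 fun P hP => ?_)
  let ψ : K ≃ₐ[K] R ⧸ P :=
    .ofBijective (Algebra.ofId K (R ⧸ P)) IsAlgClosed.algebraMap_bijective_of_isIntegral
  have hψ := hx (ψ.symm.toAlgHom.comp (Ideal.Quotient.mkₐ K P))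
  exact Ideal.Quotient.eq_zero_iff_mem.1 ((map_eq_zero_iff ψ.symm ψ.symm.injective).1 hψ)

section GroupLike

variable {A : Type*} [Ring A] [Bialgebra ℂ A] [Module.Finite ℂ A]

instance : Finite (GroupLike ℂ A) := (linearIndep_groupLikeVal (R := ℂ) (A := A)).finite

lemma exists_groupLike_of_algHom (φ : DualSpace A →ₐ[ℂ] ℂ) :
    ∃ x : GroupLike ℂ A, ∀ f : DualSpace A, φ f = f x.val := by
  obtain ⟨x, hx⟩ := EquivLike.surjective (bidual A) ((functional (DualSpace A)).symm φ.toLinearMap)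
  have hφ (f : DualSpace A) : φ f = f x := by
    rw [← bidual_apply x f, hx]; rfl
  refine ⟨⟨x, (isGroupLikeElem_map_equiv (R := ℂ) (bidual A)).1 ⟨?_, ?_⟩⟩, hφ⟩
  · rw [counit_dual, bidual_apply, ← hφ, map_one]
  · apply (pairing (DualSpace A)).injective
    ext f g
    simp [← hφ]

variable [IsCocomm ℂ A] [IsSemisimpleRing (DualSpace A)]

lemma dual_eq_zero_of_groupLike {f : DualSpace A} (hf : ∀ x : GroupLike ℂ A, f x.val = 0) :
    f = 0 := by
  let _ : CommRing (DualSpace A) :=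
    { (inferInstance : Ring (DualSpace A)) with mul_comm := dual_mul_comm }
  refine eq_zero_of_forall_algHom_eq_zero (K := ℂ) fun φ => ?_
  obtain ⟨x, hx⟩ := exists_groupLike_of_algHom φ
  rw [hx, hf]

lemma span_groupLike_eq_top :
    Submodule.span ℂ (Set.range (GroupLike.val (R := ℂ) (A := A))) = ⊤ := by
  by_contra hne
  obtain ⟨φ, hφ, hker⟩ := Submodule.exists_le_ker_of_lt_top _ (lt_top_iff_ne_top.2 hne)
  refine hφ ((functional A).symm.map_eq_zero_iff.1 (dual_eq_zero_of_groupLike fun x => ?_))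
  exact hker (Submodule.subset_span ⟨x, rfl⟩)

variable (A) in
/-- The group-like elements as a basis of a cocommutative bialgebra with semisimple dual. -/
def groupLikeBasis : Module.Basis (GroupLike ℂ A) ℂ A :=
  Module.Basis.mk linearIndep_groupLikeVal span_groupLike_eq_top.ge

@[simp] lemma groupLikeBasis_apply (s : GroupLike ℂ A) : groupLikeBasis A s = s.val := by
  rw [groupLikeBasis, Module.Basis.mk_apply]

lemma liftGroupLike_bijective :
    Function.Bijective (MonoidAlgebra.liftGroupLikeBialgHom (R := ℂ) (A := A)) := by
  have hrepr : ⇑(MonoidAlgebra.liftGroupLikeBialgHom (R := ℂ) (A := A)) =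
      (groupLikeBasis A).repr.symm ∘ MonoidAlgebra.coeff := by
    funext x
    induction x using MonoidAlgebra.induction_linear with
    | zero => simp
    | add a b ha hb => simp_all
    | single s c => simp [MonoidAlgebra.lift_single]
  rw [hrepr]
  exact (groupLikeBasis A).repr.symm.bijective.comp MonoidAlgebra.coeffEquiv.bijective

variable (A) in
/-- The isomorphism of a cocommutative bialgebra with semisimple dual and the monoid algebra of its
group-like elements. -/
def groupLikeEquiv : MonoidAlgebra ℂ (GroupLike ℂ A) ≃ₐc[ℂ] A :=
  BialgEquiv.ofBijective MonoidAlgebra.liftGroupLikeBialgHom liftGroupLike_bijective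

lemma groupLikeEquiv_single (s : GroupLike ℂ A) (c : ℂ) :
    groupLikeEquiv A (MonoidAlgebra.single s c) = c • s.val := by
  simp [groupLikeEquiv, MonoidAlgebra.lift_single]

lemma groupLikeEquiv_symm_antilinear {φ : A →ₛₗ[starRingEnd ℂ] A}
    {σ : GroupLike ℂ A → GroupLike ℂ A} (h : ∀ s, φ s.val = (σ s).val) (x : A) :
    (groupLikeEquiv A).symm (φ x) = antilinearExtension σ ((groupLikeEquiv A).symm x) := by
  obtain ⟨y, rfl⟩ := EquivLike.surjective (groupLikeEquiv A) x
  apply EquivLike.injective (groupLikeEquiv A)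
  simp only [BialgEquiv.apply_symm_apply, BialgEquiv.symm_apply_apply]
  induction y using MonoidAlgebra.induction_linear with
  | zero => simp
  | add a b ha hb => simp only [map_add, ha, hb]
  | single s c => simp [groupLikeEquiv_single, h]

end GroupLike

/-! ### Semigroups of partial isometries -/

section StarMul

variable {S : Type*} [Semigroup S] [StarMul S]

lemma star_mul_mul_star_of_mul_star_mul (hreg : ∀ s : S, s * star s * s = s) (s : S) :
    star s * s * star s = star s := by
  simpa only [star_star] using hreg (star s)

-- `g` and `star g` are the products, in the two orders, of the projections `g * star g` and
-- `star g * g`.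
lemma isSelfAdjoint_of_isIdempotentElem (hreg : ∀ s : S, s * star s * s = s)
    (hcomm : ∀ e f : S, IsStarProjection e → IsStarProjection f → Commute e f) {g : S}
    (hg : IsIdempotentElem g) : IsSelfAdjoint g := by
  have hreg' := star_mul_mul_star_of_mul_star_mul hreg g
  have hstar : star g * star g = star g := by rw [← star_mul, hg.eq]
  have hprod : g * star g * (star g * g) = g := by
    rw [mul_assoc, ← mul_assoc (star g), hstar, ← mul_assoc, hreg]
  have hprod' : star g * g * (g * star g) = star g := by
    rw [mul_assoc, ← mul_assoc g, hg.eq, ← mul_assoc, hreg']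
  have h := hcomm (g * star g) (star g * g)
    ⟨by rw [IsIdempotentElem, ← mul_assoc, hreg], .mul_star_self g⟩
    ⟨by rw [IsIdempotentElem, ← mul_assoc, hreg'], .star_mul_self g⟩
  rwa [Commute, SemiconjBy, hprod, hprod', eq_comm] at h

lemma isInverseSemigroup_of_commute_isStarProjection (hreg : ∀ s : S, s * star s * s = s)
    (hcomm : ∀ e f : S, IsStarProjection e → IsStarProjection f → Commute e f) :
    IsInverseSemigroup S := by
  have hreg' := star_mul_mul_star_of_mul_star_mul hreg
  have hidem {e f : S} (he : IsIdempotentElem e) (hf : IsIdempotentElem f) : e * f = f * e :=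
    hcomm e f ⟨he, isSelfAdjoint_of_isIdempotentElem hreg hcomm he⟩
      ⟨hf, isSelfAdjoint_of_isIdempotentElem hreg hcomm hf⟩
  refine fun a => ⟨star a, ⟨hreg a, hreg' a⟩, ?_⟩
  rintro b ⟨haba, hbab⟩
  have hab : a * star a * (a * b) = a * b * (a * star a) :=
    hidem (by rw [IsIdempotentElem, ← mul_assoc, hreg])
      (by rw [IsIdempotentElem, ← mul_assoc, haba])
  have hba : star a * a * (b * a) = b * a * (star a * a) :=
    hidem (by rw [IsIdempotentElem, ← mul_assoc, hreg'])
      (by rw [IsIdempotentElem, ← mul_assoc, hbab])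
  calc b = b * (a * star a * (a * b)) := by rw [← mul_assoc (a * star a), hreg, ← mul_assoc, hbab]
    _ = b * a * b * a * star a := by rw [hab]; simp only [mul_assoc]
    _ = b * a * (star a * a) * star a := by rw [hbab, mul_assoc _ (star a * a), hreg']
    _ = star a * (a * b * a) * star a := by rw [← hba]; simp only [mul_assoc]
    _ = star a := by rw [haba, hreg']

end StarMul

/-! ### The structure theorem -/

section Structure

variable {A : Type*} [Ring A] [Bialgebra ℂ A] {sharp flat : A →ₛₗ[starRingEnd ℂ] A}

lemma IsInvolutiveBialgebra.isGroupLikeElem_sharp (h : IsInvolutiveBialgebra sharp flat) {x : A}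
    (hx : IsGroupLikeElem ℂ x) : IsGroupLikeElem ℂ (sharp x) := by
  refine isGroupLikeElem_of_comul_eq (fun h0 => hx.ne_zero ?_) ?_
  · rw [← h.sharp_sharp x, h0, map_zero]
  · rw [h.comul_sharp, hx.comul_eq_tmul_self, TensorProduct.map_tmul]

lemma IsInvolutiveBialgebra.isGroupLikeElem_flat (h : IsInvolutiveBialgebra sharp flat) {x : A}
    (hx : IsGroupLikeElem ℂ x) : IsGroupLikeElem ℂ (flat x) := by
  refine isGroupLikeElem_of_comul_eq (fun h0 => hx.ne_zero ?_) ?_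
  · rw [← h.flat_flat x, h0, map_zero]
  · rw [h.comul_flat, hx.comul_eq_tmul_self, TensorProduct.map_tmul, TensorProduct.comm_tmul]

/-- The involution of an involutive bialgebra as a star operation on its group-like elements. -/
@[reducible] def IsInvolutiveBialgebra.groupLikeStarMul (h : IsInvolutiveBialgebra sharp flat) :
    StarMul (GroupLike ℂ A) where
  star s := ⟨sharp s.val, h.isGroupLikeElem_sharp s.2⟩
  star_involutive s := GroupLike.ext (h.sharp_sharp s.val)
  star_mul s t := GroupLike.ext (h.sharp_mul s.val t.val)

variable [Module.Finite ℂ A]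

lemma IsInvolutiveBialgebra.groupLike_mul_sharp_mul (h : IsInvolutiveBialgebra sharp flat)
    (hsharp : ∀ x, sharp x * x = 0 → x = 0) (s : GroupLike ℂ A) :
    s.val * sharp s.val * s.val = s.val := by
  let _ := h.starRing
  have : StarModule ℂ A := ⟨sharp.map_smulₛₗ⟩
  let _ := h.groupLikeStarMul
  obtain ⟨m, n, hmn, hpow⟩ := Finite.exists_ne_map_eq_of_infinite fun n : ℕ => (star s * s) ^ n
  have hpow' : (star s.val * s.val) ^ m = (star s.val * s.val) ^ n := congrArg GroupLike.val hpow
  exact IsProperStar.mul_star_mul_self hsharp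
    (IsProperStar.isIdempotentElem_star_mul_self hsharp hmn hpow')

lemma IsInvolutiveBialgebra.isInverseSemigroup_groupLike (h : IsInvolutiveBialgebra sharp flat)
    (hsharp : ∀ x, sharp x * x = 0 → x = 0) : IsInverseSemigroup (GroupLike ℂ A) := by
  let _ := h.starRing
  let _ := h.groupLikeStarMul
  refine isInverseSemigroup_of_commute_isStarProjection
    (fun s => GroupLike.ext (h.groupLike_mul_sharp_mul hsharp s)) fun e f he hf => GroupLike.ext ?_
  have hval {p : GroupLike ℂ A} (hp : IsStarProjection p) : IsStarProjection p.val :=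
    ⟨congrArg GroupLike.val hp.isIdempotentElem, congrArg GroupLike.val hp.isSelfAdjoint⟩
  exact IsProperStar.commute_of_isStarProjection hsharp (hval he) (hval hf)
    (h.groupLike_mul_sharp_mul hsharp (e * f))

lemma IsInvolutiveBialgebra.val_inv_groupLike (h : IsInvolutiveBialgebra sharp flat)
    (hsharp : ∀ x, sharp x * x = 0 → x = 0) (s : GroupLike ℂ A) :
    ((h.isInverseSemigroup_groupLike hsharp).inv s).val = sharp s.val := by
  let _ := h.groupLikeStarMul
  have hreg (t : GroupLike ℂ A) : t * star t * t = t :=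
    GroupLike.ext (h.groupLike_mul_sharp_mul hsharp t)
  exact congrArg GroupLike.val ((h.isInverseSemigroup_groupLike hsharp).eq_inv (hreg s)
    (star_mul_mul_star_of_mul_star_mul hreg s)).symm

variable [IsCocomm ℂ A]

-- Were `flat s ≠ s`, the coordinate functional `f` of `s` would satisfy `adjoint flat f * f = 0`.
lemma IsSemisimpleInvolutive.flat_groupLike (h : IsInvolutiveBialgebra sharp flat)
    (hs : IsSemisimpleInvolutive sharp flat) (s : GroupLike ℂ A) : flat s.val = s.val := by
  classical
  have := hs.coalgebra_semisimple
  by_contra hne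
  let f : DualSpace A := (functional A).symm ((groupLikeBasis A).coord s)
  have hf (t : GroupLike ℂ A) : f t.val = if t = s then 1 else 0 := by
    rw [← groupLikeBasis_apply]
    exact (groupLikeBasis A).repr_self_apply t s
  have hff : adjoint flat f * f = 0 := by
    refine dual_eq_zero_of_groupLike fun t => ?_
    have hflat := hf ⟨flat t.val, h.isGroupLikeElem_flat t.2⟩
    rw [dual_mul_apply_of_isGroupLikeElem _ _ t.2, adjoint_apply, hflat, hf]
    rcases eq_or_ne t s with rfl | ht
    · rw [if_neg fun e => hne (congrArg GroupLike.val e), map_zero, zero_mul]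
    · rw [if_neg ht, mul_zero]
  have hfs := hf s
  rw [hs.flat_proper f hff, dual_zero_apply, if_pos rfl] at hfs
  exact zero_ne_one hfs

lemma IsSemisimpleInvolutive.involutiveIso_groupLike (h : IsInvolutiveBialgebra sharp flat)
    (hs : IsSemisimpleInvolutive sharp flat) :
    InvolutiveIso sharp flat (semigroupSharp (h.isInverseSemigroup_groupLike hs.sharp_proper))
      (semigroupFlat (GroupLike ℂ A)) := by
  have := hs.coalgebra_semisimple
  exact ⟨(groupLikeEquiv A).symm,
    groupLikeEquiv_symm_antilinear fun s => (h.val_inv_groupLike hs.sharp_proper s).symm,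
    groupLikeEquiv_symm_antilinear (hs.flat_groupLike h)⟩

end Structure

end InvBialg

end

open InvBialg in
/-- The semigroup algebra `ℂ[S]` carries Mathlib's bialgebra structure (diagonal comultiplication,
counit `s ↦ 1`). On the dual, the involution is adjoint to the coinvolution and vice versa. -/
theorem theorem2 :
    (∀ (S : Type u) [Monoid S] [Finite S] (hS : IsInverseSemigroup S),
      (IsInvolutiveBialgebra (semigroupSharp hS) (semigroupFlat S) ∧
        IsSemisimpleInvolutive (semigroupSharp hS) (semigroupFlat S) ∧
        Coalgebra.IsCocomm ℂ (MonoidAlgebra ℂ S)) ∧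
      (IsInvolutiveBialgebra (adjoint (semigroupFlat S)) (adjoint (semigroupSharp hS)) ∧
        IsSemisimpleInvolutive (adjoint (semigroupFlat S)) (adjoint (semigroupSharp hS)) ∧
        ∀ f g : DualSpace (MonoidAlgebra ℂ S), f * g = g * f)) ∧
    (∀ (A : Type v) [Ring A] [Bialgebra ℂ A] [Module.Finite ℂ A]
      (sharp flat : A →ₛₗ[starRingEnd ℂ] A),
      IsInvolutiveBialgebra sharp flat → IsSemisimpleInvolutive sharp flat →
      (Coalgebra.IsCocomm ℂ A →
        ∃ (S : Type v) (_ : Monoid S) (_ : Finite S) (hS : IsInverseSemigroup S),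
          InvolutiveIso sharp flat (semigroupSharp hS) (semigroupFlat S)) ∧
      ((∀ x y : A, x * y = y * x) →
        ∃ (S : Type v) (_ : Monoid S) (_ : Finite S) (hS : IsInverseSemigroup S),
          InvolutiveIso sharp flat
            (adjoint (semigroupFlat S)) (adjoint (semigroupSharp hS)))) := by
  refine ⟨fun S _ _ hS => ?_, fun A _ _ _ sharp flat h hs => ⟨fun _ => ?_, fun hcomm => ?_⟩⟩
  · have h := isInvolutiveBialgebra_semigroupAlgebra hS
    have hs := isSemisimpleInvolutive_semigroupAlgebra hS
    exact ⟨⟨h, hs, inferInstance⟩, h.dual, hs.dual, dual_mul_comm⟩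
  · exact ⟨GroupLike ℂ A, inferInstance, inferInstance, _, hs.involutiveIso_groupLike h⟩
  · have := isCocomm_dual hcomm
    exact ⟨GroupLike ℂ (DualSpace A), inferInstance, inferInstance, _,
      (hs.dual.involutiveIso_groupLike h.dual).of_dual⟩
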